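/- Let $A$ be a unital $C^*$-algebra, with positive cone $A^+=\{b^*b : b\in A\}$. A state of $A$ is a $\mathbb{C}$-linear functional $\varphi\colon A\to\mathbb{C}$ with $\varphi(A^+)\subseteq[0,\infty)$ and $\varphi(1)=1$. Let $\mathrm{Stat}(A)$ be the convex set of all states of $A$, with the weak-* topology, i.e. the coarsest topology for which all evaluations $\varphi\mapsto\varphi(a)$, $a\in A$, are continuous. Let $\mathcal{A}(\mathrm{Stat}(A),\mathbb{C})$ be the complex vector space, with pointwise operations, of all continuous functions $f\colon\mathrm{Stat}(A)\to\mathbb{C}$ that are affine, i.e. $f(s\varphi+t\psi)=sf(\varphi)+tf(\psi)$ for all states $\varphi,\psi$ and all real $s,t\ge 0$ with $s+t=1$. Its positive cone consists of the functions with values in $[0,\infty)$, and its unit is the constant function $1$. Then the map $\xi_A\colon A\to\mathcal{A}(\mathrm{Stat}(A),\mathbb{C})$, $\xi_A(a)(\varphi)=\varphi(a)$, is a well-defined isomorphism of complex vector spaces, and both $\xi_A$ and $\xi_A^{-1}$ preserve the positive cone and the unit. -/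

import Mathlib

namespace KadisonDuality

noncomputable section

open scoped ComplexOrder

/-- The positive cone `A⁺` of a C⋆-algebra: the elements of the form `b⋆ b`. -/
def posCone (A : Type*) [CStarAlgebra A] : Set A :=
  {a | ∃ b : A, a = star b * b}

/-- The set of states of a unital C⋆-algebra, inside its algebraic dual: the linear functionals
that are positive and unital. Here `0 ≤ z` for a complex number `z` means `z ∈ [0, ∞)`.
No continuity is demanded (it is automatic). -/
def stateSet (A : Type*) [CStarAlgebra A] : Set (A →ₗ[ℂ] ℂ) :=
  {φ | (∀ a ∈ posCone A, 0 ≤ φ a) ∧ φ 1 = 1}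

/-- A convex combination of states is a state. -/
theorem convex_stateSet (A : Type*) [CStarAlgebra A] : Convex ℝ (stateSet A) := by
  intro φ hφ ψ hψ s t hs ht hst
  refine ⟨fun a ha => ?_, ?_⟩
  · have h1 := smul_nonneg hs (hφ.1 a ha)
    have h2 := smul_nonneg ht (hψ.1 a ha)
    simpa using add_nonneg h1 h2
  · have h : ((s : ℂ) + (t : ℂ)) = 1 := by exact_mod_cast hst
    simpa [hφ.2, hψ.2] using h

/-- The state space `Stat(A)`. -/
def Stat (A : Type*) [CStarAlgebra A] : Type _ :=
  {φ : A →ₗ[ℂ] ℂ // φ ∈ stateSet A}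

/-- The value `φ(a)` of a state. -/
instance (A : Type*) [CStarAlgebra A] : CoeFun (Stat A) (fun _ => A → ℂ) where
  coe φ := φ.1

/-- The weak-⋆ topology: the coarsest topology on the states for which every evaluation
`φ ↦ φ(a)` is continuous. -/
instance (A : Type*) [CStarAlgebra A] : TopologicalSpace (Stat A) :=
  ⨅ a : A, TopologicalSpace.induced (fun φ : Stat A => φ a) inferInstance

/-- The convex combination `s φ + t ψ` of two states. -/
def Stat.combo {A : Type*} [CStarAlgebra A] (s t : ℝ) (hs : 0 ≤ s) (ht : 0 ≤ t)
    (hst : s + t = 1) (φ ψ : Stat A) : Stat A :=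
  ⟨s • φ.1 + t • ψ.1, convex_stateSet A φ.2 ψ.2 hs ht hst⟩

/-- The complex vector space `𝒜(Stat(A), ℂ)` of continuous affine functions `Stat(A) → ℂ`,
with pointwise operations. -/
def affineFunctions (A : Type*) [CStarAlgebra A] : Submodule ℂ C(Stat A, ℂ) where
  carrier := {f | ∀ (s t : ℝ) (hs : 0 ≤ s) (ht : 0 ≤ t) (hst : s + t = 1) (φ ψ : Stat A),
    f (Stat.combo s t hs ht hst φ ψ) = s * f φ + t * f ψ}
  zero_mem' := by
    intro s t hs ht hst φ ψ
    simp
  add_mem' := by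
    intro f g hf hg s t hs ht hst φ ψ
    simp only [ContinuousMap.add_apply, hf s t hs ht hst φ ψ, hg s t hs ht hst φ ψ]
    ring
  smul_mem' := by
    intro c f hf s t hs ht hst φ ψ
    simp only [ContinuousMap.smul_apply, hf s t hs ht hst φ ψ, smul_eq_mul]
    ring

/-- The positive cone of `𝒜(Stat(A), ℂ)`: the functions with values in `[0, ∞)`. -/
def affinePosCone (A : Type*) [CStarAlgebra A] : Set (affineFunctions A) :=
  {f | ∀ φ : Stat A, 0 ≤ f.1 φ}

/-- The unit of `𝒜(Stat(A), ℂ)`: the constant function `1`. -/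
def affineUnit (A : Type*) [CStarAlgebra A] : affineFunctions A :=
  ⟨1, by
    intro s t hs ht hst φ ψ
    simp only [ContinuousMap.one_apply, mul_one]
    exact_mod_cast hst.symm⟩

end

end KadisonDuality

namespace KadisonDuality

open scoped ComplexOrder
open Complex ComplexStarModule

attribute [local instance] CStarAlgebra.spectralOrder CStarAlgebra.spectralOrderedRing

variable {A : Type*} [CStarAlgebra A]

/-! States detect positivity: Hahn–Banach separates a non-positive self-adjoint element from the
closed positive cone, by a functional that normalises to a state (`exists_stat_neg`). Hence
evaluation is injective, reflects positivity, and controls the norm of self-adjoint elements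
(`norm_le_of_forall_stat`). For surjectivity, `Stat A` is compact, so for real continuous affine `h`
the graphs of `h` and `h + ε` are disjoint compact convex sets. A functional separating them
involves finitely many evaluations and yields an element within `ε` of `h` (`exists_approx`). The
norm control makes a sequence of such elements Cauchy, and its limit represents `h`. -/

theorem mem_posCone_iff {a : A} : a ∈ posCone A ↔ 0 ≤ a :=
  CStarAlgebra.nonneg_iff_eq_star_mul_self.symm

theorem Stat.nonneg (φ : Stat A) {a : A} (ha : 0 ≤ a) : 0 ≤ φ a :=
  φ.2.1 a (mem_posCone_iff.2 ha)

theorem Stat.apply_one (φ : Stat A) : φ 1 = 1 := φ.2.2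

theorem Stat.apply_algebraMap (φ : Stat A) (r : ℝ) : φ (algebraMap ℝ A r) = r := by
  have h : algebraMap ℝ A r = (r : ℂ) • (1 : A) := by
    rw [Algebra.algebraMap_eq_smul_one, Complex.coe_smul]
  rw [h, map_smul, φ.apply_one, smul_eq_mul, mul_one]

/-- A state is real-valued on self-adjoint elements. -/
theorem Stat.im_apply_of_isSelfAdjoint (φ : Stat A) {a : A} (ha : IsSelfAdjoint a) :
    (φ a).im = 0 := by
  have h := φ.nonneg (sub_nonneg.2 ha.le_algebraMap_norm_self)
  rw [map_sub, φ.apply_algebraMap, Complex.nonneg_iff] at h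
  simpa using h.2.symm

theorem Stat.norm_apply_le_of_isSelfAdjoint (φ : Stat A) {a : A} (ha : IsSelfAdjoint a) :
    ‖φ a‖ ≤ ‖a‖ := by
  have h₁ := φ.nonneg (sub_nonneg.2 ha.le_algebraMap_norm_self)
  have h₂ := φ.nonneg (sub_nonneg.2 ha.neg_algebraMap_norm_le_self)
  rw [map_sub, φ.apply_algebraMap, Complex.nonneg_iff] at h₁
  rw [map_sub, map_neg, φ.apply_algebraMap, Complex.nonneg_iff] at h₂
  have h₃ : φ a = ((φ a).re : ℂ) := Complex.ext rfl (φ.im_apply_of_isSelfAdjoint ha)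
  rw [h₃, Complex.norm_real, Real.norm_eq_abs, abs_le]
  have h₄ := h₁.1
  have h₅ := h₂.1
  simp only [sub_re, neg_re, ofReal_re] at h₄ h₅
  constructor <;> linarith

theorem Stat.apply_eq (φ : Stat A) (a : A) :
    φ a = φ (ℜ a : A) + I * φ (ℑ a : A) := by
  conv_lhs => rw [← realPart_add_I_smul_imaginaryPart a]
  rw [map_add, map_smul, smul_eq_mul]

theorem Stat.re_apply (φ : Stat A) (a : A) : ((φ a).re : ℂ) = φ (ℜ a : A) := by
  rw [φ.apply_eq a]
  apply Complex.ext
  · simp [φ.im_apply_of_isSelfAdjoint (ℑ a).2]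
  · simp [φ.im_apply_of_isSelfAdjoint (ℜ a).2]

theorem Stat.im_apply (φ : Stat A) (a : A) : ((φ a).im : ℂ) = φ (ℑ a : A) := by
  rw [φ.apply_eq a]
  apply Complex.ext
  · simp [φ.im_apply_of_isSelfAdjoint (ℜ a).2]
  · simp [φ.im_apply_of_isSelfAdjoint (ℑ a).2]

theorem Stat.norm_apply_le (φ : Stat A) (a : A) : ‖φ a‖ ≤ 2 * ‖a‖ := by
  have h₁ := (φ.norm_apply_le_of_isSelfAdjoint (ℜ a).2).trans (realPart.norm_le a)
  have h₂ := (φ.norm_apply_le_of_isSelfAdjoint (ℑ a).2).trans (imaginaryPart.norm_le a)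
  rw [φ.apply_eq a]
  refine (norm_add_le _ _).trans ?_
  rw [norm_mul, norm_I, one_mul]
  linarith

/-! ### Order and norm are determined by states -/

/-- The closed cone of positive elements, in the underlying real Banach space. -/
noncomputable def nonnegCone (A : Type*) [CStarAlgebra A] : ProperCone ℝ A :=
  { PointedCone.positive ℝ A with
    isClosed' := CStarAlgebra.isClosed_nonneg }

/-- The complex-linear extension of the restriction of a real functional to the self-adjoint
elements. -/
noncomputable def hermitianExtension (f : A →ₗ[ℝ] ℝ) : A →ₗ[ℂ] ℂ :=
  Module.Dual.extendRCLike
    (f ∘ₗ (selfAdjoint.submodule ℝ A).subtype ∘ₗ (realPart : A →ₗ[ℝ] selfAdjoint A))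

theorem hermitianExtension_apply (f : A →ₗ[ℝ] ℝ) {a : A} (ha : IsSelfAdjoint a) :
    hermitianExtension f a = f a := by
  have h₁ : ((ℜ (I • a) : selfAdjoint A) : A) = 0 := by
    rw [realPart_I_smul, ha.imaginaryPart, neg_zero, ZeroMemClass.coe_zero]
  have h₂ : (f (ℜ a : A) : ℂ) - I * (f (ℜ (I • a) : A) : ℂ) = f a := by
    rw [h₁, ha.coe_realPart, map_zero, ofReal_zero, mul_zero, sub_zero]
  rw [hermitianExtension, Module.Dual.extendRCLike_apply]
  exact h₂

/-- A self-adjoint element that is not positive takes a negative value in some state. -/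
theorem exists_stat_neg {a : A} (ha : IsSelfAdjoint a) (h : ¬ 0 ≤ a) :
    ∃ φ : Stat A, (φ a).re < 0 := by
  obtain ⟨f, hf, hfa⟩ := (nonnegCone A).hyperplane_separation_point (x₀ := a) h
  replace hf : ∀ x : A, 0 ≤ x → 0 ≤ f x := hf
  -- As `-‖a‖ ≤ a`, `f a < 0` forces `‖a‖ * f 1 > 0`, so `f` can be normalised.
  have h₁ : 0 < f 1 := by
    have h := hf _ (sub_nonneg.2 ha.neg_algebraMap_norm_le_self)
    rw [map_sub, map_neg, Algebra.algebraMap_eq_smul_one, map_smul, smul_eq_mul] at h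
    have : 0 < ‖a‖ * f 1 := by linarith
    exact pos_of_mul_pos_right this (norm_nonneg a)
  refine ⟨⟨((f 1)⁻¹ : ℂ) • hermitianExtension f.toLinearMap, fun x hx => ?_, ?_⟩, ?_⟩
  · rw [mem_posCone_iff] at hx
    rw [LinearMap.smul_apply, hermitianExtension_apply _ (.of_nonneg hx), smul_eq_mul]
    have := mul_nonneg (inv_nonneg.2 h₁.le) (hf x hx)
    exact_mod_cast this
  · rw [LinearMap.smul_apply, hermitianExtension_apply _ (.one A), smul_eq_mul]
    exact inv_mul_cancel₀ (by exact_mod_cast h₁.ne')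
  · have := mul_neg_of_pos_of_neg (inv_pos.2 h₁) hfa
    change ((((f 1)⁻¹ : ℂ) • hermitianExtension f.toLinearMap) a).re < 0
    rw [LinearMap.smul_apply, hermitianExtension_apply _ ha, smul_eq_mul]
    exact_mod_cast this

theorem nonneg_of_forall_stat_re {a : A} (ha : IsSelfAdjoint a)
    (h : ∀ φ : Stat A, 0 ≤ (φ a).re) : 0 ≤ a := by
  by_contra hn
  obtain ⟨φ, hφ⟩ := exists_stat_neg ha hn
  exact (h φ).not_gt hφ

/-- From `0 ≤ a + r ≤ 2r` follows `‖a + r‖ ≤ 2r`; removing `r` costs another `r`. -/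
theorem norm_le_of_forall_stat {a : A} (ha : IsSelfAdjoint a) {r : ℝ} (hr : 0 ≤ r)
    (h : ∀ φ : Stat A, |(φ a).re| ≤ r) : ‖a‖ ≤ 3 * r := by
  have hr' : 0 ≤ algebraMap ℝ A r := algebraMap_nonneg A hr
  have hsa (t : ℝ) : IsSelfAdjoint (algebraMap ℝ A t) := .algebraMap A (.all t)
  have h₁ : 0 ≤ a + algebraMap ℝ A r := by
    refine nonneg_of_forall_stat_re (ha.add (hsa r)) fun φ => ?_
    rw [map_add, φ.apply_algebraMap, add_re, ofReal_re]
    linarith [(abs_le.1 (h φ)).1]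
  have h₂ : a + algebraMap ℝ A r ≤ algebraMap ℝ A (2 * r) := by
    rw [← sub_nonneg]
    refine nonneg_of_forall_stat_re ((hsa _).sub (ha.add (hsa r))) fun φ => ?_
    rw [map_sub, map_add, φ.apply_algebraMap, φ.apply_algebraMap]
    simp only [add_re, sub_re, ofReal_re]
    linarith [(abs_le.1 (h φ)).2]
  have h₃ := (CStarAlgebra.norm_le_iff_le_algebraMap _ (by positivity) h₁).2 h₂
  have h₄ := (CStarAlgebra.norm_le_iff_le_algebraMap _ hr hr').2 le_rfl
  have h₅ := norm_sub_le (a + algebraMap ℝ A r) (algebraMap ℝ A r)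
  rw [add_sub_cancel_right] at h₅
  linarith

theorem eq_zero_of_forall_stat {a : A} (h : ∀ φ : Stat A, φ a = 0) : a = 0 := by
  have key (b : A) (hb : IsSelfAdjoint b) (hb' : ∀ φ : Stat A, φ b = 0) : b = 0 := by
    have := norm_le_of_forall_stat hb le_rfl (fun φ => by simp [hb' φ])
    simpa using this
  rw [← realPart_add_I_smul_imaginaryPart a,
    key _ (ℜ a).2 fun φ => by rw [← φ.re_apply, h φ]; simp,
    key _ (ℑ a).2 fun φ => by rw [← φ.im_apply, h φ]; simp]
  simp

theorem nonneg_of_forall_stat {a : A} (h : ∀ φ : Stat A, 0 ≤ φ a) : 0 ≤ a := by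
  have him : (ℑ a : A) = 0 := eq_zero_of_forall_stat fun φ => by
    rw [← φ.im_apply, ← (Complex.nonneg_iff.1 (h φ)).2, ofReal_zero]
  have ha : a = (ℜ a : A) := by
    conv_lhs => rw [← realPart_add_I_smul_imaginaryPart a, him, smul_zero, add_zero]
  have hsa : IsSelfAdjoint a := by rw [ha]; exact (ℜ a).2
  exact nonneg_of_forall_stat_re hsa fun φ => (Complex.nonneg_iff.1 (h φ)).1

/-! ### Weak-⋆ compactness -/

theorem isInducing_stat : Topology.IsInducing (fun (φ : Stat A) (a : A) => φ a) :=
  ⟨(induced_to_pi (fun (φ : Stat A) (a : A) => φ a)).symm⟩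

theorem continuous_stat_apply (a : A) : Continuous fun φ : Stat A => φ a :=
  (continuous_apply a).comp isInducing_stat.continuous

/-- Pointwise closed conditions: with `Stat.norm_apply_le`, Tychonoff then gives compactness. -/
theorem range_stat : Set.range (fun (φ : Stat A) (a : A) => φ a) =
    {x : A → ℂ | (∀ a b, x (a + b) = x a + x b) ∧ (∀ (c : ℂ) a, x (c • a) = c * x a) ∧
      (∀ a ∈ posCone A, 0 ≤ x a) ∧ x 1 = 1} := by
  ext x
  constructor
  · rintro ⟨φ, rfl⟩
    exact ⟨map_add φ.1, fun c a => map_smul φ.1 c a, φ.2.1, φ.2.2⟩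
  · rintro ⟨h₁, h₂, h₃, h₄⟩
    exact ⟨⟨{ toFun := x, map_add' := h₁, map_smul' := h₂ }, h₃, h₄⟩, rfl⟩

theorem isClosed_range_stat : IsClosed (Set.range (fun (φ : Stat A) (a : A) => φ a)) := by
  rw [range_stat]
  refine .and ?_ (.and ?_ (.and ?_ ?_))
  · simp only [Set.ofPred_forall]
    exact isClosed_iInter fun a => isClosed_iInter fun b =>
      isClosed_eq (continuous_apply _) (.add (continuous_apply a) (continuous_apply b))
  · simp only [Set.ofPred_forall]
    exact isClosed_iInter fun c => isClosed_iInter fun a =>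
      isClosed_eq (continuous_apply _) (continuous_const.mul (continuous_apply _))
  · simp only [Set.ofPred_forall]
    exact isClosed_iInter fun a => isClosed_iInter fun _ =>
      isClosed_le continuous_const (continuous_apply a)
  · exact isClosed_eq (continuous_apply _) continuous_const

/-- The state space is compact. -/
instance : CompactSpace (Stat A) := by
  rw [← isCompact_univ_iff, isInducing_stat.isCompact_iff, Set.image_univ]
  refine (isCompact_univ_pi fun a : A => isCompact_closedBall (0 : ℂ) (2 * ‖a‖)).of_isClosed_subset
    isClosed_range_stat ?_
  rintro _ ⟨φ, rfl⟩ a -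
  simpa using φ.norm_apply_le a

/-! ### Representing continuous affine functions -/

/-- A continuous linear functional on a real product space is a finite combination of
coordinates. -/
theorem exists_finset_sum_of_continuous {ι : Type*} (g : (ι → ℝ) →L[ℝ] ℝ) :
    ∃ (F : Finset ι) (c : ι → ℝ), ∀ x, g x = ∑ i ∈ F, c i * x i := by
  classical
  have hU : {x | |g x| < 1} ∈ nhds (0 : ι → ℝ) :=
    (isOpen_lt g.continuous.abs continuous_const).mem_nhds (by simp)
  rw [nhds_pi, Filter.mem_pi] at hU
  obtain ⟨F, hF, t, ht, hU⟩ := hU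
  -- Rescaling `x` to `g x = 1` would keep it in the neighbourhood where `|g| < 1`.
  have hzero (x : ι → ℝ) (hx : ∀ i ∈ F, x i = 0) : g x = 0 := by
    by_contra hne
    have h : (g x)⁻¹ • x ∈ {x | |g x| < 1} := hU fun i hi => by
      simpa [hx i hi] using mem_of_mem_nhds (ht i)
    simp [hne] at h
  refine ⟨hF.toFinset, fun i => g (Pi.single i 1), fun x => ?_⟩
  have h := hzero (x - ∑ i ∈ hF.toFinset, x i • Pi.single i 1) fun i hi => by
    simp [Finset.sum_apply, Pi.single_apply, hi]
  rw [map_sub, map_sum, sub_eq_zero] at h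
  rw [h]
  exact Finset.sum_congr rfl fun i _ => by rw [map_smul, smul_eq_mul, mul_comm]

/-- The graph of a real function on the state space, in a locally convex space. -/
noncomputable def statGraph (h : Stat A → ℝ) (φ : Stat A) : (A → ℝ) × ℝ :=
  (fun a => (φ a).re, h φ)

theorem continuous_statGraph {h : Stat A → ℝ} (hc : Continuous h) : Continuous (statGraph h) :=
  (continuous_pi fun a => continuous_re.comp (continuous_stat_apply a)).prodMk hc

theorem isCompact_range_statGraph {h : Stat A → ℝ} (hc : Continuous h) :
    IsCompact (Set.range (statGraph h)) :=
  isCompact_range (continuous_statGraph hc)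

theorem convex_range_statGraph {h : Stat A → ℝ}
    (ha : ∀ (s t : ℝ) (hs : 0 ≤ s) (ht : 0 ≤ t) (hst : s + t = 1) (φ ψ : Stat A),
      h (Stat.combo s t hs ht hst φ ψ) = s * h φ + t * h ψ) :
    Convex ℝ (Set.range (statGraph h)) := by
  rintro _ ⟨φ, rfl⟩ _ ⟨ψ, rfl⟩ s t hs ht hst
  refine ⟨Stat.combo s t hs ht hst φ ψ, Prod.ext (funext fun a => ?_) (ha s t hs ht hst φ ψ)⟩
  change ((s • φ.1 + t • ψ.1) a).re = s • (φ a).re + t • (ψ a).re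
  simp

/-- `Im φ(a) = -Re φ(I • a)`, so real coordinates suffice to keep the two graphs disjoint. -/
theorem stat_ext {φ ψ : Stat A} (h : ∀ a, (φ a).re = (ψ a).re) : φ = ψ := by
  refine Subtype.ext (LinearMap.ext fun a => Complex.ext (h a) ?_)
  have := h (I • a)
  rw [map_smul, map_smul] at this
  simpa using this

/-- A continuous affine real function on the state space is uniformly approximated by
self-adjoint elements. -/
theorem exists_approx {h : Stat A → ℝ} (hc : Continuous h)
    (ha : ∀ (s t : ℝ) (hs : 0 ≤ s) (ht : 0 ≤ t) (hst : s + t = 1) (φ ψ : Stat A),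
      h (Stat.combo s t hs ht hst φ ψ) = s * h φ + t * h ψ) {ε : ℝ} (hε : 0 < ε) :
    ∃ a : A, IsSelfAdjoint a ∧ ∀ φ : Stat A, |(φ a).re - h φ| ≤ ε := by
  -- The zero algebra has no states; a state is needed below for `0 < d`.
  rcases isEmpty_or_nonempty (Stat A) with hS | ⟨⟨φ₀⟩⟩
  · exact ⟨0, .zero A, fun φ => hS.elim φ⟩
  obtain ⟨g, u, v, hu, huv, hv⟩ := geometric_hahn_banach_compact_closed
    (convex_range_statGraph ha) (isCompact_range_statGraph hc)
    (convex_range_statGraph (h := fun φ => h φ + ε) fun s t hs ht hst φ ψ => by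
      rw [ha]; linear_combination -ε * hst)
    (isCompact_range_statGraph (hc.add continuous_const)).isClosed (by
      rw [Set.disjoint_left]
      rintro _ ⟨φ, rfl⟩ ⟨ψ, hψ⟩
      have hφψ : ψ = φ := stat_ext fun a => congrFun (congrArg Prod.fst hψ) a
      have := congrArg Prod.snd hψ
      simp only [statGraph, hφψ] at this
      linarith)
  obtain ⟨F, c, hF⟩ := exists_finset_sum_of_continuous
    (g.comp (ContinuousLinearMap.inl ℝ (A → ℝ) ℝ))
  set b : A := ∑ a ∈ F, (c a : ℂ) • a with hb
  set d : ℝ := g (0, 1) with hd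
  have hg (φ : Stat A) (t : ℝ) : g (fun a => (φ a).re, t) = (φ b).re + t * d := by
    have h₁ : ((fun a => (φ a).re, t) : (A → ℝ) × ℝ) =
        (fun a => (φ a).re, 0) + t • (0, 1) := by simp
    have h₂ : g (fun a => (φ a).re, 0) = ∑ a ∈ F, c a * (φ a).re := hF _
    rw [h₁, map_add, map_smul, h₂, hb, map_sum, re_sum, smul_eq_mul, hd]
    simp
  have hu' (φ : Stat A) : (φ b).re + h φ * d < u := by
    rw [← hg]; exact hu _ ⟨φ, rfl⟩
  have hv' (φ : Stat A) : u < (φ b).re + (h φ + ε) * d := by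
    rw [← hg]; exact huv.trans (hv _ ⟨φ, rfl⟩)
  have hd0 : 0 < d := by
    have : 0 < ε * d := by linarith [hu' φ₀, hv' φ₀]
    exact pos_of_mul_pos_right this hε.le
  -- Solving `Re φ(b) + t * d = u` for the height `t` of the separating hyperplane, which lies
  -- between `h φ` and `h φ + ε`.
  refine ⟨d⁻¹ • (algebraMap ℝ A u - (ℜ b : A)),
    .smul (.all _) ((IsSelfAdjoint.algebraMap A (.all u)).sub (ℜ b).2), fun φ => ?_⟩
  have hval : (φ (d⁻¹ • (algebraMap ℝ A u - (ℜ b : A)))).re = (u - (φ b).re) / d := by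
    rw [← Complex.coe_smul, map_smul, map_sub, φ.apply_algebraMap, ← φ.re_apply, smul_eq_mul,
      ← ofReal_sub, ← ofReal_mul, ofReal_re, inv_mul_eq_div]
  have h₁ : h φ ≤ (u - (φ b).re) / d := by
    rw [le_div_iff₀ hd0]; linarith [hu' φ]
  have h₂ : (u - (φ b).re) / d ≤ h φ + ε := by
    rw [div_le_iff₀ hd0]; linarith [hv' φ]
  rw [hval, abs_le]
  constructor <;> linarith

/-- A continuous affine real function on the state space is represented by a self-adjoint
element. -/
theorem exists_eq_of_real {h : Stat A → ℝ} (hc : Continuous h)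
    (ha : ∀ (s t : ℝ) (hs : 0 ≤ s) (ht : 0 ≤ t) (hst : s + t = 1) (φ ψ : Stat A),
      h (Stat.combo s t hs ht hst φ ψ) = s * h φ + t * h ψ) :
    ∃ a : A, ∀ φ : Stat A, φ a = h φ := by
  have hε (n : ℕ) : 0 < ((1 : ℝ) / 2) ^ n := by positivity
  choose x hx hxh using fun n => exists_approx hc ha (hε n)
  -- `6 = 3 * 2`: the norm constant times the bound on consecutive errors.
  have hd (n : ℕ) : dist (x n) (x (n + 1)) ≤ 6 * (1 / 2 : ℝ) ^ n := by
    rw [dist_eq_norm]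
    have := norm_le_of_forall_stat ((hx n).sub (hx (n + 1)))
      (r := 2 * (1 / 2 : ℝ) ^ n) (by positivity) fun φ => by
        have h₁ := abs_le.1 (hxh n φ)
        have h₂ := abs_le.1 (hxh (n + 1) φ)
        rw [pow_succ] at h₂
        rw [map_sub, sub_re, abs_le]
        constructor <;> linarith [h₁.1, h₁.2, h₂.1, h₂.2, hε n]
    linarith
  obtain ⟨a, hxa⟩ := cauchySeq_tendsto_of_complete
    (cauchySeq_of_le_geometric _ _ (by norm_num) hd)
  have hasa : IsSelfAdjoint a :=
    (isClosed_eq continuous_star continuous_id).mem_of_tendsto hxa (.of_forall hx)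
  refine ⟨a, fun φ => ?_⟩
  have hφ : Continuous φ.1 :=
    AddMonoidHomClass.continuous_of_bound φ.1 2 φ.norm_apply_le
  have h₁ : Filter.Tendsto (fun n => (φ (x n)).re) .atTop (nhds (φ a).re) :=
    ((continuous_re.comp hφ).tendsto a).comp hxa
  have h₂ : Filter.Tendsto (fun n => (φ (x n)).re) .atTop (nhds (h φ)) := by
    rw [tendsto_iff_dist_tendsto_zero]
    refine squeeze_zero (fun _ => dist_nonneg) (fun n => hxh n φ)
      (tendsto_pow_atTop_nhds_zero_of_lt_one (by norm_num) (by norm_num))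
  rw [← tendsto_nhds_unique h₁ h₂]
  exact Complex.ext rfl (φ.im_apply_of_isSelfAdjoint hasa)

/-- Evaluation, as a linear map into the continuous affine functions. -/
noncomputable def evalMap (A : Type*) [CStarAlgebra A] : A →ₗ[ℂ] affineFunctions A where
  toFun a := ⟨⟨fun φ => φ a, continuous_stat_apply a⟩, fun s t hs ht hst φ ψ => by
    change (s • φ.1 + t • ψ.1) a = s * φ a + t * ψ a
    simp⟩
  map_add' a b := Subtype.ext (ContinuousMap.ext fun φ => map_add φ.1 a b)
  map_smul' c a := Subtype.ext (ContinuousMap.ext fun φ => map_smul φ.1 c a)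

theorem evalMap_apply (a : A) (φ : Stat A) : (evalMap A a).1 φ = φ a := rfl

theorem evalMap_injective : Function.Injective (evalMap A) := by
  rw [injective_iff_map_eq_zero]
  intro a ha
  refine eq_zero_of_forall_stat fun φ => ?_
  rw [← evalMap_apply, ha]
  rfl

theorem evalMap_surjective : Function.Surjective (evalMap A) := by
  intro f
  obtain ⟨a, ha⟩ := exists_eq_of_real (continuous_re.comp f.1.continuous)
    fun s t hs ht hst φ ψ => by simp [f.2 s t hs ht hst φ ψ]
  obtain ⟨b, hb⟩ := exists_eq_of_real (continuous_im.comp f.1.continuous)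
    fun s t hs ht hst φ ψ => by simp [f.2 s t hs ht hst φ ψ]
  refine ⟨a + I • b, Subtype.ext (ContinuousMap.ext fun φ => ?_)⟩
  rw [evalMap_apply, map_add, map_smul, ha, hb, smul_eq_mul, mul_comm]
  exact re_add_im _

end KadisonDuality

/-- Evaluation `a ↦ (φ ↦ φ(a))` is an isomorphism of complex vector spaces from `A` onto the
continuous affine functions on the state space, and it and its inverse preserve the positive cone
and the unit. -/
theorem mainTheorem3 (A : Type*) [CStarAlgebra A] :
    ∃ ξ : A ≃ₗ[ℂ] KadisonDuality.affineFunctions A,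
      (∀ (a : A) (φ : KadisonDuality.Stat A), (ξ a).1 φ = φ a) ∧
      (∀ a ∈ KadisonDuality.posCone A, ξ a ∈ KadisonDuality.affinePosCone A) ∧
      (∀ f ∈ KadisonDuality.affinePosCone A, ξ.symm f ∈ KadisonDuality.posCone A) ∧
      ξ 1 = KadisonDuality.affineUnit A ∧
      ξ.symm (KadisonDuality.affineUnit A) = 1 := by
  have hone : KadisonDuality.evalMap A 1 = KadisonDuality.affineUnit A :=
    Subtype.ext (ContinuousMap.ext fun φ => φ.apply_one)
  let ξ := LinearEquiv.ofBijective (KadisonDuality.evalMap A)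
    ⟨KadisonDuality.evalMap_injective, KadisonDuality.evalMap_surjective⟩
  refine ⟨ξ, fun a φ => rfl, fun a ha φ => φ.2.1 a ha, fun f hf => ?_, hone, ?_⟩
  · obtain ⟨a, rfl⟩ := ξ.surjective f
    rw [ξ.symm_apply_apply, KadisonDuality.mem_posCone_iff]
    exact KadisonDuality.nonneg_of_forall_stat hf
  · exact ξ.symm_apply_eq.2 hone.symm
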